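/- For a positive integer $Q$ and a set $Y$, let $\mathscr{Q}_Q(Y)$ denote the set of unordered $Q$-tuples $[\![y_1,\dots,y_Q]\!]$ of elements of $Y$ (the quotient of $Y^Q$ by the permutation action of the symmetric group $S_Q$). If $(Y,d)$ is a metric space, equip $\mathscr{Q}_Q(Y)$ with the metric $$\mathscr{G}_\infty\big([\![y_1,\dots,y_Q]\!],[\![y'_1,\dots,y'_Q]\!]\big)=\min_{\sigma\in S_Q}\ \max_{1\le i\le Q} d\big(y_i,y'_{\sigma(i)}\big).$$ Theorem. For all integers $Q\ge 1$ and $m\ge 0$ there is a constant $c(m,Q)\ge 1$, depending only on $m$ and $Q$, with the following property. Let $X$ be a finite dimensional real Banach space with $\dim X=m$, let $A\subset X$ be closed, let $Y$ be a real Banach space, and let $f:A\to\mathscr{Q}_Q(Y)$ be Lipschitz with respect to $\mathscr{G}_\infty$. Then $f$ admits an extension $\hat f:X\to\mathscr{Q}_Q(Y)$ such that $$\operatorname{Lip}\hat f\le c(m,Q)\,\operatorname{Lip} f ,$$ and, if $A\neq\emptyset$, such that moreover for every $v\in\mathscr{Q}_Q(Y)$, with suprema taken in $[0,+\infty]$,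 $$\sup\{\mathscr{G}_\infty(\hat f(x),v):x\in X\}\le c(m,Q)\,\sup\{\mathscr{G}_\infty(f(x),v):x\in A\}.$$ Here $\operatorname{Lip}$ denotes the least Lipschitz constant. -/

import Mathlib

open scoped NNReal ENNReal

namespace QValued

variable {Y : Type*} {Q : ℕ}

/-- The unordered `Q`-tuple `[[y₁, …, y_Q]]`. The set of unordered `Q`-tuples of elements of `Y`
is Mathlib's symmetric power `Sym Y Q`; see `bracket_surjective` and `bracket_eq_bracket_iff`. -/
def bracket (y : Fin Q → Y) : Sym Y Q :=
  ⟨(Finset.univ : Finset (Fin Q)).val.map y, by simp⟩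

theorem bracket_surjective : Function.Surjective (bracket : (Fin Q → Y) → Sym Y Q) := by
  rintro ⟨s, hs⟩
  induction s using Quotient.inductionOn with
  | h l =>
    have hl : l.length = Q := by simpa using hs
    subst hl
    refine ⟨l.get, Subtype.ext ?_⟩
    simp [bracket, Fin.univ_val_map]

/-- Two `Q`-tuples define the same unordered tuple iff they differ by a permutation. -/
theorem bracket_eq_bracket_iff (y y' : Fin Q → Y) :
    bracket y = bracket y' ↔ ∃ σ : Equiv.Perm (Fin Q), y' ∘ σ = y := by
  classical
  constructor
  · intro h
    have hm : (Finset.univ : Finset (Fin Q)).val.map y = (Finset.univ : Finset (Fin Q)).val.map y' :=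
      congrArg Subtype.val h
    have hc : ∀ b : Y, Fintype.card {i // y i = b} = Fintype.card {i // y' i = b} := by
      intro b
      have hb := congrArg (Multiset.count b) hm
      rw [Multiset.count_map, Multiset.count_map] at hb
      rw [Fintype.card_subtype, Fintype.card_subtype, Finset.card_def, Finset.card_def,
        Finset.filter_val, Finset.filter_val]
      simpa only [eq_comm] using hb
    refine ⟨Equiv.ofFiberEquiv (f := y) (g := y') fun b => Fintype.equivOfCardEq (hc b), ?_⟩
    funext i
    exact Equiv.ofFiberEquiv_map _ i
  · rintro ⟨σ, rfl⟩
    have h : (Finset.univ : Finset (Fin Q)).val.map (y' ∘ σ) =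
        (Finset.univ : Finset (Fin Q)).val.map y' := by
      rw [← Multiset.map_map, Multiset.map_univ_val_equiv]
    exact Subtype.ext h

section Metric

variable [MetricSpace Y]

/-- The distance `𝒢_∞`: the least value of `max_i d(y_i, y'_i)` over all numberings
`v = [[y₁, …, y_Q]]` and `w = [[y'₁, …, y'_Q]]`; see `gInf_bracket` for the formula
`min_σ max_i d(y_i, y'_{σ(i)})` in terms of fixed numberings. -/
noncomputable def gInf (v w : Sym Y Q) : ℝ :=
  sInf {r : ℝ | ∃ y y' : Fin Q → Y,
    bracket y = v ∧ bracket y' = w ∧ r = ⨆ i, dist (y i) (y' i)}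

theorem iSup_dist (y y' : Fin Q → Y) : ⨆ i, dist (y i) (y' i) = dist y y' := by
  apply le_antisymm
  · exact Real.iSup_le (fun i => dist_le_pi_dist y y' i) dist_nonneg
  · exact (dist_pi_le_iff (Real.iSup_nonneg fun i => dist_nonneg)).2
      fun i => le_ciSup (f := fun i => dist (y i) (y' i)) (Set.finite_range _).bddAbove i

theorem dist_comp_perm (y y' : Fin Q → Y) (σ : Equiv.Perm (Fin Q)) :
    dist (y ∘ σ) (y' ∘ σ) = dist y y' := by
  rw [← iSup_dist, ← iSup_dist]
  exact σ.iSup_comp (g := fun i => dist (y i) (y' i))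

theorem gInf_bracket (y y' : Fin Q → Y) :
    gInf (bracket y) (bracket y') =
      ⨅ σ : Equiv.Perm (Fin Q), ⨆ i, dist (y i) (y' (σ i)) := by
  rw [gInf, iInf]
  congr 1
  ext r
  constructor
  · rintro ⟨z, z', hz, hz', rfl⟩
    obtain ⟨σ, rfl⟩ := (bracket_eq_bracket_iff _ _).1 hz
    obtain ⟨τ, rfl⟩ := (bracket_eq_bracket_iff _ _).1 hz'
    refine ⟨σ.symm.trans τ, ?_⟩
    exact (σ.iSup_comp (g := fun i => dist (y i) (y' ((σ.symm.trans τ) i)))).symm.trans (by simp)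
  · rintro ⟨σ, rfl⟩
    exact ⟨y, y' ∘ σ, rfl, (bracket_eq_bracket_iff _ _).2 ⟨σ, rfl⟩, rfl⟩

theorem gInf_le (y y' : Fin Q → Y) : gInf (bracket y) (bracket y') ≤ dist y y' := by
  rw [gInf_bracket, ← iSup_dist]
  exact ciInf_le (Set.finite_range _).bddBelow (1 : Equiv.Perm (Fin Q))

/-- The minimum is attained. -/
theorem exists_gInf_eq (y : Fin Q → Y) (w : Sym Y Q) :
    ∃ y' : Fin Q → Y, bracket y' = w ∧ gInf (bracket y) w = dist y y' := by
  obtain ⟨z, rfl⟩ := bracket_surjective w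
  obtain ⟨σ, hσ⟩ := exists_eq_ciInf_of_finite
    (f := fun σ : Equiv.Perm (Fin Q) => ⨆ i, dist (y i) (z (σ i)))
  refine ⟨z ∘ σ, (bracket_eq_bracket_iff _ _).2 ⟨σ, rfl⟩, ?_⟩
  rw [gInf_bracket, ← hσ, ← iSup_dist]
  rfl

theorem gInf_comm (v w : Sym Y Q) : gInf v w = gInf w v := by
  unfold gInf
  congr 1
  ext r
  constructor
  · rintro ⟨y, y', h, h', rfl⟩
    exact ⟨y', y, h', h, by simp only [dist_comm]⟩
  · rintro ⟨y, y', h, h', rfl⟩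
    exact ⟨y', y, h', h, by simp only [dist_comm]⟩

/-- Unordered `Q`-tuples of points of a metric space carry the metric `𝒢_∞`. -/
noncomputable instance instMetricSpaceSym : MetricSpace (Sym Y Q) where
  dist := gInf
  dist_self v := by
    obtain ⟨y, rfl⟩ := bracket_surjective v
    refine le_antisymm ((gInf_le y y).trans_eq (dist_self y)) ?_
    obtain ⟨y', -, h⟩ := exists_gInf_eq y (bracket y)
    exact h ▸ dist_nonneg
  dist_comm := gInf_comm
  dist_triangle u v w := by
    obtain ⟨y, rfl⟩ := bracket_surjective u
    obtain ⟨y', rfl, h⟩ := exists_gInf_eq y v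
    obtain ⟨y'', rfl, h'⟩ := exists_gInf_eq y' w
    rw [h, h']
    exact (gInf_le y y'').trans (dist_triangle y y' y'')
  eq_of_dist_eq_zero {v w} h := by
    obtain ⟨y, rfl⟩ := bracket_surjective v
    obtain ⟨y', rfl, h'⟩ := exists_gInf_eq y w
    rw [eq_of_dist_eq_zero (h'.symm.trans h)]

theorem dist_eq_gInf (v w : Sym Y Q) : dist v w = gInf v w := rfl

end Metric

end QValued

/-!
Each ball in the space of unordered `Q`-tuples of points of a normed space `Y` contracts to a point,
with bounds independent of `Y` (`QValued.contractibleBalls_sym`). Given `v = [[y₁, …, y_Q]]` and `r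
≥ 0`, the `y_i` are grouped into clusters by joining points at distance at most `4 * r`. A cluster
has diameter at most `4 * Q * r`, and two points, each within `r` of some `y_i`, that are at
distance at most `2 * r` from each other lie near the same cluster. Moving each point linearly to
the centre of its cluster therefore preserves optimal matchings, shrinks distances, and moves points
by at most `(4 * Q + 1) * r`.

A space with this property is a target for Lipschitz extension from closed subsets `A` of a
finite-dimensional space. The complement of `A` is covered by Whitney balls `B(s, d(s)/8)`, where
`d` is the distance to `A`; by a packing bound and a greedy colouring, a number of colours depending
only on the dimension suffices to make the doubled balls of each colour disjoint
(`exists_colored_whitney_net`). The construction starts from the discontinuous map `x ↦ f (p x)`,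
with `p x` an almost nearest point of `A`, and processes the colours one after the other: inside
`B(s, d(s)/4)` the current value is moved along a contraction of a ball around `f (p s)`, of radius
comparable to `L * d(s)`, up to a time given by a cut-off function (`exists_contraction_step`). Each
stage adds a controlled amount to the oscillation and moves values by a controlled multiple of
`L * d(x)`; the radii grow from one colour to the next to account for this. Where the cut-off equals
`1` the contraction is complete and the past is forgotten, including the discontinuity of the
initial map. As this happens at every point for some colour, the final map is Lipschitz.

To preserve bounds, `L * d(s)` is replaced by `min (L * d(s)) D` when the values of `f` have
diameter `D < ∞`; both cases are covered by the notion of an `IsSublinearModulus`.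
-/

/-! ### Contractions of balls of unordered tuples -/

/-- Every ball of `T` contracts to a point, uniformly over centres and radii: the contraction
shrinks distances by the factor `1 - t` at time `t`, and the tracks have speed at most `C` times
the radius. Nothing is required of `H` outside the ball, apart from `H 0 = id`; in particular `H 1`
is constant on the ball, and its value need not be `v`. -/
def ContractibleBalls (T : Type*) [MetricSpace T] (C : ℝ) : Prop :=
  ∀ (v : T) (r : ℝ), 0 ≤ r → ∃ H : ℝ → T → T, (∀ w, H 0 w = w) ∧
    (∀ t ∈ Set.Icc (0 : ℝ) 1, ∀ w ∈ Metric.closedBall v r, ∀ w' ∈ Metric.closedBall v r,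
      dist (H t w) (H t w') ≤ (1 - t) * dist w w') ∧
    (∀ t ∈ Set.Icc (0 : ℝ) 1, ∀ t' ∈ Set.Icc (0 : ℝ) 1, ∀ w ∈ Metric.closedBall v r,
      dist (H t w) (H t' w) ≤ C * r * |t - t'|)

namespace QValued

theorem map_bracket {Y Z : Type*} {Q : ℕ} (h : Y → Z) (y : Fin Q → Y) :
    Sym.map h (bracket y) = bracket (h ∘ y) :=
  Subtype.ext (Multiset.map_map h y (Finset.univ : Finset (Fin Q)).val)

theorem exists_dist_le_of_mem_closedBall {Y : Type*} [MetricSpace Y] {Q : ℕ} {y z : Fin Q → Y}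
    {r : ℝ} (h : bracket z ∈ Metric.closedBall (bracket y) r) (i : Fin Q) :
    ∃ j, dist (z i) (y j) ≤ r := by
  obtain ⟨z', hz', hd⟩ := exists_gInf_eq y (bracket z)
  obtain ⟨σ, rfl⟩ := (bracket_eq_bracket_iff _ _).1 hz'
  refine ⟨σ.symm i, ?_⟩
  have h1 : dist y (z ∘ σ) ≤ r := by
    rw [← hd, ← dist_eq_gInf, dist_comm]
    exact h
  have h2 := (dist_le_pi_dist y (z ∘ σ) (σ.symm i)).trans h1
  rw [dist_comm]
  simpa using h2

/-- Points `y i` are put in the same cluster when they are joined by a chain of steps of length at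
most `4 * r`; the map `c` sends the points near a cluster to a chosen member of it. -/
theorem exists_cluster_map {Y : Type*} [MetricSpace Y] {Q : ℕ} (y : Fin Q → Y) {r : ℝ}
    (hr : 0 ≤ r) :
    ∃ c : Y → Y,
      (∀ i j z z', dist z (y i) ≤ r → dist z' (y j) ≤ r → dist z z' ≤ 2 * r → c z = c z') ∧
      (∀ i z, dist z (y i) ≤ r → dist z (c z) ≤ (4 * Q + 1) * r) := by
  classical
  let G : SimpleGraph (Fin Q) := SimpleGraph.fromRel fun i j => dist (y i) (y j) ≤ 4 * r
  have hG : ∀ i j, G.Adj i j → dist (y i) (y j) ≤ 4 * r := by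
    intro i j h
    rcases ((SimpleGraph.fromRel_adj _ _ _).1 h).2 with h | h
    · exact h
    · rwa [dist_comm]
  have hG' : ∀ i j, dist (y i) (y j) ≤ 4 * r → G.Reachable i j := by
    intro i j h
    by_cases hij : i = j
    · subst hij; exact SimpleGraph.Reachable.refl _
    · exact SimpleGraph.Adj.reachable ((SimpleGraph.fromRel_adj _ _ _).2 ⟨hij, Or.inl h⟩)
  have hwalk : ∀ i j (p : G.Walk i j), dist (y i) (y j) ≤ p.length * (4 * r) := by
    intro i j p
    induction p with
    | nil => simp
    | cons h p ih =>
      refine (dist_triangle _ _ _).trans ((add_le_add (hG _ _ h) ih).trans_eq ?_)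
      rw [SimpleGraph.Walk.length_cons]
      push_cast
      ring
  have hreach : ∀ i j, G.Reachable i j → dist (y i) (y j) ≤ 4 * Q * r := by
    intro i j h
    obtain ⟨p, hp⟩ := h.exists_isPath
    have h1 : p.length ≤ Q := by simpa using hp.length_lt.le
    calc dist (y i) (y j) ≤ p.length * (4 * r) := hwalk i j p
      _ ≤ Q * (4 * r) := by gcongr
      _ = _ := by ring
  let rep : Fin Q → Fin Q := fun i => (G.connectedComponentMk i).out
  have hrep : ∀ i, G.Reachable i (rep i) := fun i =>
    (SimpleGraph.ConnectedComponent.eq.1 (Quot.out_eq (G.connectedComponentMk i))).symm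
  have hrep' : ∀ i j, G.Reachable i j → rep i = rep j := fun i j h => by
    simp only [rep, SimpleGraph.ConnectedComponent.eq.2 h]
  let c : Y → Y := fun z => if h : ∃ i, dist z (y i) ≤ r then y (rep h.choose) else z
  have hc : ∀ i z, dist z (y i) ≤ r → ∃ k, dist z (y k) ≤ r ∧ c z = y (rep k) := by
    intro i z h
    have h' : ∃ i, dist z (y i) ≤ r := ⟨i, h⟩
    exact ⟨h'.choose, h'.choose_spec, dif_pos h'⟩
  refine ⟨c, ?_, ?_⟩
  · intro i j z z' hz hz' hzz
    obtain ⟨k, hk, hck⟩ := hc i z hz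
    obtain ⟨l, hl, hcl⟩ := hc j z' hz'
    rw [hck, hcl, hrep' k l (hG' _ _ _)]
    have h1 := dist_triangle4 (y k) z z' (y l)
    rw [dist_comm (y k) z] at h1
    linarith
  · intro i z hz
    obtain ⟨k, hk, hck⟩ := hc i z hz
    rw [hck]
    have h1 := dist_triangle z (y k) (y (rep k))
    have h2 := hreach _ _ (hrep k)
    linarith

/-- Each point `z` moves along the segment to the centre of its cluster. Points of two nearby
unordered tuples that are matched with each other lie near the same cluster, so matchings persist
and all matched distances shrink by the same factor. -/
theorem contractibleBalls_sym (Y : Type*) [NormedAddCommGroup Y] [NormedSpace ℝ Y] (Q : ℕ) :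
    ContractibleBalls (Sym Y Q) (4 * Q + 1) := by
  intro v r hr
  obtain ⟨y, rfl⟩ := bracket_surjective v
  obtain ⟨c, hc, hc'⟩ := exists_cluster_map y hr
  refine ⟨fun t => Sym.map fun z => AffineMap.lineMap z (c z) t, ?_, ?_, ?_⟩
  · intro w
    simp
  · intro t ht w hw w' hw'
    obtain ⟨z, rfl⟩ := bracket_surjective w
    obtain ⟨z', rfl, hd⟩ := exists_gInf_eq z w'
    have hzz : dist z z' ≤ 2 * r := by
      rw [← hd, ← dist_eq_gInf]
      have := dist_triangle_right (bracket z) (bracket z') (bracket y)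
      rw [Metric.mem_closedBall] at hw hw'
      linarith
    simp only [map_bracket]
    refine (gInf_le _ _).trans ?_
    rw [dist_eq_gInf, hd]
    have ht1 : 0 ≤ 1 - t := by linarith [ht.2]
    refine (dist_pi_le_iff (by positivity)).2 fun i => ?_
    obtain ⟨j, hj⟩ := exists_dist_le_of_mem_closedBall hw i
    obtain ⟨k, hk⟩ := exists_dist_le_of_mem_closedBall hw' i
    have hi := dist_le_pi_dist z z' i
    have hci := hc j k _ _ hj hk (hi.trans hzz)
    have : dist (AffineMap.lineMap (z i) (c (z i)) t) (AffineMap.lineMap (z' i) (c (z' i)) t)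
        = (1 - t) * dist (z i) (z' i) := by
      rw [hci, AffineMap.lineMap_apply_module, AffineMap.lineMap_apply_module, dist_add_right,
        dist_smul₀, Real.norm_of_nonneg ht1]
    exact this.trans_le (by gcongr)
  · intro t _ t' _ w hw
    obtain ⟨z, rfl⟩ := bracket_surjective w
    simp only [map_bracket]
    refine (gInf_le _ _).trans ((dist_pi_le_iff (by positivity)).2 fun i => ?_)
    obtain ⟨j, hj⟩ := exists_dist_le_of_mem_closedBall hw i
    have : dist (AffineMap.lineMap (z i) (c (z i)) t) (AffineMap.lineMap (z i) (c (z i)) t')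
        = |t - t'| * dist (z i) (c (z i)) := by
      rw [dist_lineMap_lineMap, Real.dist_eq]
    refine this.trans_le ?_
    rw [mul_comm]
    gcongr
    exact hc' j _ hj

end QValued

/-! ### Whitney coverings with boundedly many colours -/

/-- Volume bound for the number of `r`-separated points in a ball of radius `R`. -/
theorem card_le_of_separated_of_subset_closedBall {E : Type*} [NormedAddCommGroup E]
    [NormedSpace ℝ E] [FiniteDimensional ℝ E] (s : Finset E) (x : E) {r R : ℝ} (hr : 0 < r)
    (hR : 0 ≤ R) (hs : ∀ a ∈ s, dist a x ≤ R) (h : ∀ a ∈ s, ∀ b ∈ s, a ≠ b → r ≤ dist a b) :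
    (s.card : ℝ) ≤ (2 * R / r + 1) ^ Module.finrank ℝ E := by
  borelize E
  let μ : MeasureTheory.Measure E := MeasureTheory.Measure.addHaar
  have hr2 : 0 < r / 2 := by positivity
  have hρ : 0 < R + r / 2 := by positivity
  have hdisj : (s : Set E).PairwiseDisjoint fun a => Metric.ball a (r / 2) := by
    intro a ha b hb hab
    exact Metric.ball_disjoint_ball (by linarith [h a ha b hb hab])
  have hsub : ⋃ a ∈ s, Metric.ball a (r / 2) ⊆ Metric.ball x (R + r / 2) :=
    Set.iUnion₂_subset fun a ha => Metric.ball_subset_ball' (by linarith [hs a ha])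
  have hvol : (s.card : ℝ≥0∞) * ENNReal.ofReal ((r / 2) ^ Module.finrank ℝ E) *
      μ (Metric.ball 0 1) ≤
      ENNReal.ofReal ((R + r / 2) ^ Module.finrank ℝ E) * μ (Metric.ball 0 1) := by
    have h1 := MeasureTheory.measure_mono (μ := μ) hsub
    rw [MeasureTheory.measure_biUnion_finset hdisj fun _ _ => measurableSet_ball] at h1
    simpa only [μ.addHaar_ball_of_pos _ hr2, μ.addHaar_ball_of_pos _ hρ, Finset.sum_const,
      nsmul_eq_mul, mul_assoc] using h1
  have hvol' := (ENNReal.mul_le_mul_iff_left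
    (Metric.measure_ball_pos _ _ zero_lt_one).ne' MeasureTheory.measure_ball_lt_top.ne).1 hvol
  have hreal := ENNReal.toReal_le_of_le_ofReal (by positivity) hvol'
  rw [ENNReal.toReal_mul, ENNReal.toReal_natCast, ENNReal.toReal_ofReal (by positivity),
    ← le_div_iff₀ (by positivity), ← div_pow] at hreal
  refine hreal.trans_eq ?_
  congr 1
  field_simp

/-- Greedy colouring along a well-order: a graph, possibly infinite, in which every vertex has
fewer than `N` neighbours can be coloured with `N` colours. -/
theorem exists_coloring_of_card_neighbors_lt {α : Type*} (G : α → α → Prop)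
    (hsymm : ∀ a b, G a b → G b a) {N : ℕ}
    (hN : ∀ a (t : Finset α), (∀ b ∈ t, G a b) → t.card < N) :
    ∃ χ : α → ℕ, (∀ a, χ a < N) ∧ ∀ a b, a ≠ b → G a b → χ a ≠ χ b := by
  classical
  have hfin : ∀ a, {b | G a b}.Finite := by
    intro a
    by_contra hinf
    obtain ⟨t, ht, hcard⟩ := Set.Infinite.exists_subset_card_eq hinf N
    exact (hN a t fun b hb => ht hb).ne hcard
  have wf : WellFounded (WellOrderingRel : α → α → Prop) := WellOrderingRel.isWellOrder.wf
  have hchoice : ∀ (a : α) (χ : α → ℕ), ∃ n < N, ∀ b, G a b → χ b ≠ n := by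
    intro a χ
    have h1 : ((hfin a).toFinset.image χ).card < (Finset.range N).card := by
      rw [Finset.card_range]
      exact Finset.card_image_le.trans_lt (hN a _ fun b hb => by simpa using hb)
    obtain ⟨n, hn, hn'⟩ := Finset.exists_mem_notMem_of_card_lt_card h1
    refine ⟨n, Finset.mem_range.1 hn, fun b hb hbn => hn' ?_⟩
    exact Finset.mem_image.2 ⟨b, by simpa using hb, hbn⟩
  let step : ∀ a, (∀ b, WellOrderingRel b a → ℕ) → ℕ := fun a ih =>
    (hchoice a fun b => if h : WellOrderingRel b a then ih b h else 0).choose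
  have hstep : ∀ a, wf.fix step a = step a fun b _ => wf.fix step b := fun a =>
    wf.fix_eq step a
  have hlt : ∀ a, wf.fix step a < N := by
    intro a
    rw [hstep]
    exact (hchoice a _).choose_spec.1
  have hne : ∀ a b, WellOrderingRel b a → G a b → wf.fix step a ≠ wf.fix step b := by
    intro a b hba hab heq
    have h1 := (hchoice a fun b => if WellOrderingRel b a then wf.fix step b else 0).choose_spec.2
      b hab
    rw [if_pos hba, ← heq, hstep] at h1
    exact h1 rfl
  refine ⟨wf.fix step, hlt, fun a b hab hG => ?_⟩
  rcases trichotomous_of (WellOrderingRel : α → α → Prop) a b with h | h | h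
  · exact (hne b a h (hsymm _ _ hG)).symm
  · exact absurd h hab
  · exact hne a b h hG

/-- A maximal subset of `Aᶜ` whose points are separated by `1/16` of their distances to `A`. -/
theorem exists_whitney_net {X : Type*} [MetricSpace X] {A : Set X} (hA : IsClosed A)
    (hne : A.Nonempty) :
    ∃ S : Set X, (∀ s ∈ S, s ∉ A) ∧
      (∀ s ∈ S, ∀ s' ∈ S, s ≠ s' → Metric.infDist s A / 16 ≤ dist s s') ∧
      (∀ x ∉ A, ∃ s ∈ S, dist x s ≤ Metric.infDist s A / 8) := by
  let F : Set (Set X) := {S | (∀ s ∈ S, s ∉ A) ∧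
    ∀ s ∈ S, ∀ s' ∈ S, s ≠ s' → Metric.infDist s A / 16 ≤ dist s s'}
  obtain ⟨S, hS⟩ := zorn_subset F (by
    intro c hcF hc
    refine ⟨⋃₀ c, ⟨?_, ?_⟩, fun s hs => Set.subset_sUnion_of_mem hs⟩
    · rintro s ⟨U, hU, hs⟩
      exact (hcF hU).1 s hs
    · rintro s ⟨U, hU, hs⟩ s' ⟨V, hV, hs'⟩ hss
      rcases hc.total hU hV with h | h
      · exact (hcF hV).2 s (h hs) s' hs' hss
      · exact (hcF hU).2 s hs s' (h hs') hss)
  refine ⟨S, hS.prop.1, hS.prop.2, fun x hx => ?_⟩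
  by_contra! hfar
  have hx0 : 0 < Metric.infDist x A := (hA.notMem_iff_infDist_pos hne).1 hx
  have key : ∀ s ∈ S, Metric.infDist s A / 16 ≤ dist x s ∧ Metric.infDist x A / 16 ≤ dist x s := by
    intro s hs
    have h1 := hfar s hs
    have h2 : Metric.infDist x A ≤ Metric.infDist s A + dist x s :=
      Metric.infDist_le_infDist_add_dist
    have h3 : 0 ≤ Metric.infDist s A := Metric.infDist_nonneg
    constructor <;> linarith
  have hins : insert x S ∈ F := by
    refine ⟨?_, ?_⟩
    · rintro s (rfl | hs)
      · exact hx
      · exact hS.prop.1 s hs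
    · rintro s (rfl | hs) s' (rfl | hs') hss
      · exact absurd rfl hss
      · exact (key s' hs').2
      · rw [dist_comm]; exact (key s hs).1
      · exact hS.prop.2 s hs s' hs' hss
  have hxS : x ∈ S := hS.le_of_ge hins (Set.subset_insert x S) (Set.mem_insert x S)
  have := hfar x hxS
  rw [dist_self] at this
  linarith

/-- Whitney balls `B(s, d(s)/8)` cover the complement of `A`, and the doubled balls
`B(s, d(s)/4)` of each colour are disjoint; the number of colours depends on the dimension only. -/
theorem exists_colored_whitney_net {X : Type*} [NormedAddCommGroup X] [NormedSpace ℝ X]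
    [FiniteDimensional ℝ X] {A : Set X} (hA : IsClosed A) (hne : A.Nonempty) :
    ∃ S : ℕ → Set X, (∀ c, ∀ s ∈ S c, s ∉ A) ∧
      (∀ c, ∀ s ∈ S c, ∀ s' ∈ S c, ∀ x, dist x s < Metric.infDist s A / 4 →
        dist x s' < Metric.infDist s' A / 4 → s = s') ∧
      (∀ x ∉ A, ∃ c < 37 ^ Module.finrank ℝ X + 1, ∃ s ∈ S c,
        dist x s ≤ Metric.infDist s A / 8) := by
  obtain ⟨S, hSA, hsep, hcov⟩ := exists_whitney_net hA hne
  let G : S → S → Prop := fun s s' =>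
    dist (s : X) s' < (Metric.infDist (s : X) A + Metric.infDist (s' : X) A) / 4
  have hcomp : ∀ s s' : S, G s s' →
      Metric.infDist (s' : X) A ≤ 5 / 3 * Metric.infDist (s : X) A := by
    intro s s' h
    have h1 : Metric.infDist (s' : X) A ≤ Metric.infDist (s : X) A + dist (s' : X) s :=
      Metric.infDist_le_infDist_add_dist
    rw [dist_comm] at h1
    have h2 : dist (s : X) s' < _ := h
    linarith
  have hsymm : ∀ s s' : S, G s s' → G s' s := by
    intro s s' h
    change dist (s' : X) s < _
    rw [dist_comm, add_comm]
    exact h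
  obtain ⟨χ, hχ, hχ'⟩ := exists_coloring_of_card_neighbors_lt G hsymm
    (N := 37 ^ Module.finrank ℝ X + 1) (by
      intro s t ht
      have hs0 : 0 < Metric.infDist (s : X) A := (hA.notMem_iff_infDist_pos hne).1 (hSA s s.2)
      have hcard := card_le_of_separated_of_subset_closedBall
        (t.map (Function.Embedding.subtype _)) (s : X)
        (r := 3 / 80 * Metric.infDist (s : X) A) (R := 2 / 3 * Metric.infDist (s : X) A)
        (by positivity) (by positivity)
        (by
          intro a ha
          obtain ⟨b, hb, rfl⟩ := Finset.mem_map.1 ha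
          have h1 : dist (s : X) b < _ := ht b hb
          have h2 := hcomp _ _ (ht b hb)
          change dist (b : X) s ≤ _
          rw [dist_comm]
          linarith)
        (by
          intro a ha b hb hab
          obtain ⟨a, ha', rfl⟩ := Finset.mem_map.1 ha
          obtain ⟨b, hb', rfl⟩ := Finset.mem_map.1 hb
          have h1 := hsep a a.2 b b.2 hab
          have h2 := hcomp _ _ (hsymm _ _ (ht a ha'))
          change _ ≤ dist (a : X) b
          linarith)
      rw [Finset.card_map] at hcard
      have h3 : 2 * (2 / 3 * Metric.infDist (s : X) A) / (3 / 80 * Metric.infDist (s : X) A) + 1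
          ≤ 37 := by
        have : 2 * (2 / 3 * Metric.infDist (s : X) A) / (3 / 80 * Metric.infDist (s : X) A)
            = 320 / 9 := by
          field_simp
          norm_num
        rw [this]
        norm_num
      have h4 : (t.card : ℝ) ≤ 37 ^ Module.finrank ℝ X :=
        hcard.trans (pow_le_pow_left₀ (by positivity) h3 _)
      exact Nat.lt_succ_of_le (by exact_mod_cast h4))
  refine ⟨fun c => {x | ∃ h : x ∈ S, χ ⟨x, h⟩ = c}, ?_, ?_, ?_⟩
  · rintro c s ⟨hs, -⟩
    exact hSA s hs
  · rintro c s ⟨hs, hsc⟩ s' ⟨hs', hsc'⟩ x hx hx'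
    by_contra hss
    refine hχ' ⟨s, hs⟩ ⟨s', hs'⟩ (fun h => hss (congrArg Subtype.val h)) ?_ (hsc.trans hsc'.symm)
    have := dist_triangle_left s s' x
    change dist s s' < _
    linarith
  · intro x hx
    obtain ⟨s, hs, hxs⟩ := hcov x hx
    exact ⟨χ ⟨s, hs⟩, hχ _, s, ⟨hs, rfl⟩, hxs⟩

/-! ### Smoothing by successive contractions -/

/-- A modulus of continuity on `[0, ∞)` that is dominated by `s ↦ L * s` and grows at most
linearly under dilations. The two examples needed are `L * s` and `min (L * s) D`. -/
structure IsSublinearModulus (μ : ℝ → ℝ) (L : ℝ) : Prop where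
  mono : Monotone μ
  nonneg : ∀ s, 0 ≤ s → 0 ≤ μ s
  le_mul : ∀ s, 0 ≤ s → μ s ≤ L * s
  dilate : ∀ k s, 1 ≤ k → 0 ≤ s → μ (k * s) ≤ k * μ s

theorem isSublinearModulus_mul {L : ℝ} (hL : 0 ≤ L) :
    IsSublinearModulus (fun s => L * s) L where
  mono _ _ h := mul_le_mul_of_nonneg_left h hL
  nonneg _ hs := mul_nonneg hL hs
  le_mul _ _ := le_rfl
  dilate k s _ _ := by simp only [mul_left_comm, le_refl]

theorem isSublinearModulus_min {L D : ℝ} (hL : 0 ≤ L) (hD : 0 ≤ D) :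
    IsSublinearModulus (fun s => min (L * s) D) L where
  mono _ _ h := min_le_min_right _ (mul_le_mul_of_nonneg_left h hL)
  nonneg _ hs := le_min (mul_nonneg hL hs) hD
  le_mul _ _ := min_le_left _ _
  dilate k s hk _ := by
    rw [mul_min_of_nonneg _ _ (zero_le_one.trans hk), mul_left_comm]
    exact min_le_min_left _ (le_mul_of_one_le_left hD hk)

/-- The cut-off function of the Whitney ball with centre `s` and scale `δ`: it is `1` on the ball of
radius `δ / 8` and `0` off the ball of radius `δ / 4`. -/
noncomputable def cutoff {X : Type*} [MetricSpace X] (δ : ℝ) (s x : X) : ℝ :=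
  max 0 (min 1 (2 - 8 * dist x s / δ))

section Cutoff

variable {X : Type*} [MetricSpace X] {δ : ℝ} {s x : X}

theorem cutoff_mem_Icc : cutoff δ s x ∈ Set.Icc (0 : ℝ) 1 :=
  ⟨le_max_left _ _, max_le zero_le_one (min_le_left _ _)⟩

theorem cutoff_eq_one (hδ : 0 < δ) (h : dist x s ≤ δ / 8) : cutoff δ s x = 1 := by
  have : 8 * dist x s / δ ≤ 1 := (div_le_one hδ).2 (by linarith)
  rw [cutoff, min_eq_left (by linarith), max_eq_right zero_le_one]

theorem cutoff_eq_zero (hδ : 0 < δ) (h : δ / 4 ≤ dist x s) : cutoff δ s x = 0 := by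
  have : 2 ≤ 8 * dist x s / δ := (le_div_iff₀ hδ).2 (by linarith)
  exact max_eq_left ((min_le_right _ _).trans (by linarith))

theorem abs_cutoff_sub_le (hδ : 0 < δ) (x' : X) :
    |cutoff δ s x - cutoff δ s x'| ≤ 8 * dist x x' / δ := by
  have h1 : |cutoff δ s x - cutoff δ s x'| ≤
      |(2 - 8 * dist x s / δ) - (2 - 8 * dist x' s / δ)| := by
    refine (abs_max_sub_max_le_max _ _ _ _).trans (max_le (by simp) ?_)
    exact (abs_min_sub_min_le_max _ _ _ _).trans (max_le (by simp) le_rfl)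
  refine h1.trans ?_
  have h2 : (2 - 8 * dist x s / δ) - (2 - 8 * dist x' s / δ) =
      8 * (dist x' s - dist x s) / δ := by ring
  rw [h2, abs_div, abs_mul, abs_of_pos hδ, abs_of_pos (by norm_num : (0 : ℝ) < 8)]
  gcongr
  rw [dist_comm x x']
  exact abs_dist_sub_le _ _ _

end Cutoff

/-- One colour of the construction: in each ball `B(s, d(s)/4)`, `s ∈ S`, the current value is moved
along the contraction of a ball around `φ s` of radius `(5 + 2 * M) * μ (d s)`, up to the time
prescribed by the cut-off function of that ball. The three conclusions bound the displacement, the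
growth of the oscillation, and the oscillation between `x` and any other point when `x` lies in some
`B(s, d(s)/8)`: there the contraction is completed, so the previous values do not matter. -/
theorem exists_contraction_step {X T : Type*} [MetricSpace X] [MetricSpace T] {C M L : ℝ}
    (hC : 0 ≤ C) (hM : 0 ≤ M) (hL : 0 ≤ L) (hT : ContractibleBalls T C) {μ : ℝ → ℝ}
    (hμ : IsSublinearModulus μ L) {Ω : Set X} {d : X → ℝ} (hd0 : ∀ x ∈ Ω, 0 < d x)
    (hd : ∀ x y, d x ≤ d y + dist x y) {φ : X → T}
    (hφ : ∀ x ∈ Ω, ∀ y ∈ Ω, dist (φ x) (φ y) ≤ μ (2 * d x + 2 * d y + dist x y))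
    {S : Set X} (hSΩ : S ⊆ Ω)
    (hS : ∀ s ∈ S, ∀ s' ∈ S, ∀ x, dist x s < d s / 4 → dist x s' < d s' / 4 → s = s') :
    ∃ Φ : X → T → T,
      (∀ x ∈ Ω, ∀ w, dist w (φ x) ≤ M * μ (d x) →
        dist (Φ x w) w ≤ 2 * C * (5 + 2 * M) * μ (d x)) ∧
      (∀ x ∈ Ω, ∀ y ∈ Ω, ∀ w w', dist w (φ x) ≤ M * μ (d x) → dist w' (φ y) ≤ M * μ (d y) →
        dist (Φ x w) (Φ y w') ≤ dist w w' + 16 * C * (5 + 2 * M) * (L * dist x y)) ∧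
      (∀ x ∈ Ω, ∀ y ∈ Ω, ∀ w w', dist w (φ x) ≤ M * μ (d x) → dist w' (φ y) ≤ M * μ (d y) →
        (∃ s ∈ S, dist x s ≤ d s / 8) →
        dist (Φ x w) (Φ y w') ≤
          (38 * C * (5 + 2 * M) + 19 * M + 39) * (L * dist x y)) := by
  classical
  set K : ℝ := 5 + 2 * M with hK
  have hK0 : 0 ≤ K := by positivity
  have hHex : ∀ s, ∃ H : ℝ → T → T, s ∈ S → (∀ w, H 0 w = w) ∧
      (∀ t ∈ Set.Icc (0 : ℝ) 1, ∀ w ∈ Metric.closedBall (φ s) (K * μ (d s)),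
        ∀ w' ∈ Metric.closedBall (φ s) (K * μ (d s)),
        dist (H t w) (H t w') ≤ (1 - t) * dist w w') ∧
      (∀ t ∈ Set.Icc (0 : ℝ) 1, ∀ t' ∈ Set.Icc (0 : ℝ) 1,
        ∀ w ∈ Metric.closedBall (φ s) (K * μ (d s)),
        dist (H t w) (H t' w) ≤ C * (K * μ (d s)) * |t - t'|) := by
    intro s
    by_cases hs : s ∈ S
    · obtain ⟨H, hH⟩ := hT (φ s) (K * μ (d s))
        (mul_nonneg hK0 (hμ.nonneg _ (hd0 s (hSΩ hs)).le))
      exact ⟨H, fun _ => hH⟩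
    · exact ⟨fun _ w => w, fun h => absurd h hs⟩
  choose H hH using hHex
  let Φ : X → T → T := fun x w =>
    if h : ∃ s ∈ S, dist x s < d s / 4 then H h.choose (cutoff (d h.choose) h.choose x) w else w
  have hΦ1 : ∀ s ∈ S, ∀ x w, dist x s < d s / 4 → Φ x w = H s (cutoff (d s) s x) w := by
    intro s hs x w hx
    have h : ∃ s ∈ S, dist x s < d s / 4 := ⟨s, hs, hx⟩
    have hs' : h.choose = s := hS _ h.choose_spec.1 s hs x h.choose_spec.2 hx
    simp only [Φ, dif_pos h, hs']
  have hΦ2 : ∀ x w, (∀ s ∈ S, ¬ dist x s < d s / 4) → Φ x w = w := by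
    intro x w hx
    have h : ¬ ∃ s ∈ S, dist x s < d s / 4 := by
      rintro ⟨s, hs, h⟩
      exact hx s hs h
    simp only [Φ, dif_neg h]
  -- The constant `5 + 2 * M` is chosen so that the current value lies in the ball being contracted.
  have hball : ∀ s ∈ S, ∀ x ∈ Ω, ∀ w, dist x s < d s / 4 → dist w (φ x) ≤ M * μ (d x) →
      w ∈ Metric.closedBall (φ s) (K * μ (d s)) := by
    intro s hs x hx w hxs hw
    have hs0 := hd0 s (hSΩ hs)
    have h1 : d x ≤ 5 / 4 * d s := by linarith [hd x s]
    have h2 : μ (d x) ≤ 2 * μ (d s) :=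
      (hμ.mono (by linarith)).trans (hμ.dilate 2 (d s) (by norm_num) hs0.le)
    have h3 : dist (φ x) (φ s) ≤ 5 * μ (d s) :=
      (hφ x hx s (hSΩ hs)).trans
        ((hμ.mono (by linarith)).trans (hμ.dilate 5 (d s) (by norm_num) hs0.le))
    have h4 : M * μ (d x) ≤ M * (2 * μ (d s)) := by gcongr
    rw [Metric.mem_closedBall]
    have h5 := dist_triangle w (φ x) (φ s)
    rw [hK]
    linarith
  have htime : ∀ s ∈ S, ∀ x y : X, C * (K * μ (d s)) * |cutoff (d s) s x - cutoff (d s) s y| ≤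
      8 * C * K * (L * dist x y) := by
    intro s hs x y
    have hs0 := hd0 s (hSΩ hs)
    have hμ0 := hμ.nonneg _ hs0.le
    calc C * (K * μ (d s)) * |cutoff (d s) s x - cutoff (d s) s y|
        ≤ C * (K * (L * d s)) * (8 * dist x y / d s) := by
          gcongr
          · exact hμ.le_mul _ hs0.le
          · exact abs_cutoff_sub_le hs0 y
      _ = _ := by field_simp
  have hdisp : ∀ x ∈ Ω, ∀ w, dist w (φ x) ≤ M * μ (d x) →
      dist (Φ x w) w ≤ 2 * C * K * μ (d x) := by
    intro x hx w hw
    have hx0 := hd0 x hx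
    by_cases h : ∃ s ∈ S, dist x s < d s / 4
    · obtain ⟨s, hs, hxs⟩ := h
      have hs0 := hd0 s (hSΩ hs)
      have hμ0 := hμ.nonneg _ hs0.le
      have h1 := (hH s hs).2.2 (cutoff (d s) s x) cutoff_mem_Icc 0 (by simp) w
        (hball s hs x hx w hxs hw)
      rw [(hH s hs).1, sub_zero, abs_of_nonneg cutoff_mem_Icc.1] at h1
      rw [hΦ1 s hs x w hxs]
      have h2 : d s ≤ 2 * d x := by
        have := hd s x
        rw [dist_comm] at this
        linarith
      have h3 : μ (d s) ≤ 2 * μ (d x) :=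
        (hμ.mono h2).trans (hμ.dilate 2 (d x) (by norm_num) hx0.le)
      calc _ ≤ C * (K * μ (d s)) * cutoff (d s) s x := h1
        _ ≤ C * (K * (2 * μ (d x))) * 1 := by
          have := hμ.nonneg _ hx0.le
          gcongr
          · exact cutoff_mem_Icc.1
          · exact cutoff_mem_Icc.2
        _ = _ := by ring
    · rw [hΦ2 x w fun s hs hxs => h ⟨s, hs, hxs⟩, dist_self]
      have := hμ.nonneg _ hx0.le
      positivity
  have hmove : ∀ x ∈ Ω, ∀ y, ∀ w, dist w (φ x) ≤ M * μ (d x) →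
      (¬ ∃ s ∈ S, dist x s < d s / 4 ∧ dist y s < d s / 4) →
      dist (Φ x w) w ≤ 8 * C * K * (L * dist x y) := by
    intro x hx y w hw hxy
    by_cases h : ∃ s ∈ S, dist x s < d s / 4
    · obtain ⟨s, hs, hxs⟩ := h
      have hys : d s / 4 ≤ dist y s := not_lt.1 fun hys => hxy ⟨s, hs, hxs, hys⟩
      have h1 := (hH s hs).2.2 (cutoff (d s) s x) cutoff_mem_Icc (cutoff (d s) s y)
        cutoff_mem_Icc w (hball s hs x hx w hxs hw)
      have h2 := h1.trans (htime s hs x y)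
      rwa [cutoff_eq_zero (hd0 s (hSΩ hs)) hys, (hH s hs).1, ← hΦ1 s hs x w hxs] at h2
    · rw [hΦ2 x w fun s hs hxs => h ⟨s, hs, hxs⟩, dist_self]
      positivity
  -- Two points in a common ball: contract `w` and `w'` for the same time, then adjust the time.
  have hcommon : ∀ s ∈ S, ∀ x ∈ Ω, ∀ y ∈ Ω, ∀ w w', dist x s < d s / 4 → dist y s < d s / 4 →
      dist w (φ x) ≤ M * μ (d x) → dist w' (φ y) ≤ M * μ (d y) →
      dist (Φ x w) (Φ y w') ≤
        (1 - cutoff (d s) s x) * dist w w' + 8 * C * K * (L * dist x y) := by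
    intro s hs x hx y hy w w' hxs hys hw hw'
    rw [hΦ1 s hs x w hxs, hΦ1 s hs y w' hys]
    have hb := hball s hs x hx w hxs hw
    have hb' := hball s hs y hy w' hys hw'
    exact (dist_triangle _ (H s (cutoff (d s) s x) w') _).trans (add_le_add
      ((hH s hs).2.1 _ cutoff_mem_Icc w hb w' hb')
      (((hH s hs).2.2 _ cutoff_mem_Icc _ cutoff_mem_Icc w' hb').trans (htime s hs x y)))
  refine ⟨Φ, hdisp, ?_, ?_⟩
  · intro x hx y hy w w' hw hw'
    have hpos : 0 ≤ C * K * (L * dist x y) := by positivity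
    by_cases h : ∃ s ∈ S, dist x s < d s / 4 ∧ dist y s < d s / 4
    · obtain ⟨s, hs, hxs, hys⟩ := h
      have h1 := hcommon s hs x hx y hy w w' hxs hys hw hw'
      have h2 : (1 - cutoff (d s) s x) * dist w w' ≤ 1 * dist w w' := by
        gcongr
        linarith [(cutoff_mem_Icc (δ := d s) (s := s) (x := x)).1]
      linarith
    · have h1 := hmove x hx y w hw h
      have h2 := hmove y hy x w' hw' fun ⟨s, hs, h1, h2⟩ => h ⟨s, hs, h2, h1⟩
      have h3 := dist_triangle4 (Φ x w) w w' (Φ y w')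
      rw [dist_comm w' (Φ y w')] at h3
      rw [dist_comm y x] at h2
      linarith
  · rintro x hx y hy w w' hw hw' ⟨s, hs, hxs⟩
    have hs0 := hd0 s (hSΩ hs)
    have hpos : 0 ≤ C * K * (L * dist x y) := by positivity
    have hpos' : 0 ≤ M * (L * dist x y) := by positivity
    have hpos'' : 0 ≤ L * dist x y := by positivity
    by_cases hys : dist y s < d s / 4
    · have h1 := hcommon s hs x hx y hy w w' (by linarith) hys hw hw'
      rw [cutoff_eq_one hs0 hxs] at h1
      linarith
    -- Here `x` and `y` are at least `d s / 8` apart, so the displacement bounds suffice.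
    · have hxy : d s / 8 ≤ dist x y := by
        have := dist_triangle_left y s x
        linarith
      have hx0 := hd0 x hx
      have hy0 := hd0 y hy
      have hx9 : d x ≤ 9 * dist x y := by linarith [hd x s]
      have hy10 : d y ≤ 10 * dist x y := by
        have := hd y x
        rw [dist_comm] at this
        linarith
      have hμx : μ (d x) ≤ L * (9 * dist x y) := (hμ.le_mul _ hx0.le).trans (by gcongr)
      have hμy : μ (d y) ≤ L * (10 * dist x y) := (hμ.le_mul _ hy0.le).trans (by gcongr)
      have h1 : dist (Φ x w) (φ x) ≤ (2 * C * K + M) * (L * (9 * dist x y)) :=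
        calc _ ≤ dist (Φ x w) w + dist w (φ x) := dist_triangle _ _ _
          _ ≤ 2 * C * K * μ (d x) + M * μ (d x) := add_le_add (hdisp x hx w hw) hw
          _ = (2 * C * K + M) * μ (d x) := by ring
          _ ≤ _ := by gcongr
      have h2 : dist (Φ y w') (φ y) ≤ (2 * C * K + M) * (L * (10 * dist x y)) :=
        calc _ ≤ dist (Φ y w') w' + dist w' (φ y) := dist_triangle _ _ _
          _ ≤ 2 * C * K * μ (d y) + M * μ (d y) := add_le_add (hdisp y hy w' hw') hw'
          _ = (2 * C * K + M) * μ (d y) := by ring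
          _ ≤ _ := by gcongr
      have h3 : dist (φ x) (φ y) ≤ L * (39 * dist x y) :=
        (hφ x hx y hy).trans ((hμ.le_mul _ (by positivity)).trans
          (mul_le_mul_of_nonneg_left (by linarith) hL))
      have h4 := dist_triangle4 (Φ x w) (φ x) (φ y) (Φ y w')
      rw [dist_comm (φ y)] at h4
      linarith

/-- The bound for the displacement, in units of `μ (d x)`, after the first `n` colours. -/
def displacementConst (C : ℝ) : ℕ → ℝ
  | 0 => 0
  | n + 1 => displacementConst C n + 2 * C * (5 + 2 * displacementConst C n)

/-- The bound for the Lipschitz constant, in units of `L`, after the first `n` colours. -/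
def oscillationConst (C : ℝ) : ℕ → ℝ
  | 0 => 0
  | n + 1 => oscillationConst C n + (38 * C * (5 + 2 * displacementConst C n) +
      19 * displacementConst C n + 39)

theorem displacementConst_nonneg {C : ℝ} (hC : 0 ≤ C) (n : ℕ) : 0 ≤ displacementConst C n := by
  induction n with
  | zero => exact le_rfl
  | succ n ih => rw [displacementConst]; positivity

theorem oscillationConst_nonneg {C : ℝ} (hC : 0 ≤ C) (n : ℕ) : 0 ≤ oscillationConst C n := by
  induction n with
  | zero => exact le_rfl
  | succ n ih =>
    have := displacementConst_nonneg hC n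
    rw [oscillationConst]
    positivity

/-- The colours are processed one after the other, starting from the discontinuous map `φ`. The
result is Lipschitz because every point lies in some ball `B(s, d(s)/8)`, where the values before
that stage are forgotten. -/
theorem exists_lipschitz_modification {X T : Type*} [MetricSpace X] [MetricSpace T] {C L : ℝ}
    (hC : 0 ≤ C) (hL : 0 ≤ L) (hT : ContractibleBalls T C) {μ : ℝ → ℝ}
    (hμ : IsSublinearModulus μ L) {Ω : Set X} {d : X → ℝ} (hd0 : ∀ x ∈ Ω, 0 < d x)
    (hd : ∀ x y, d x ≤ d y + dist x y) {φ : X → T}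
    (hφ : ∀ x ∈ Ω, ∀ y ∈ Ω, dist (φ x) (φ y) ≤ μ (2 * d x + 2 * d y + dist x y))
    {S : ℕ → Set X} (hSΩ : ∀ c, S c ⊆ Ω)
    (hS : ∀ c, ∀ s ∈ S c, ∀ s' ∈ S c, ∀ x, dist x s < d s / 4 → dist x s' < d s' / 4 → s = s')
    (n : ℕ) :
    ∃ g : X → T, (∀ x ∈ Ω, dist (g x) (φ x) ≤ displacementConst C n * μ (d x)) ∧
      ∀ x ∈ Ω, ∀ y ∈ Ω, (∃ c < n, ∃ s ∈ S c, dist x s ≤ d s / 8) →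
        dist (g x) (g y) ≤ oscillationConst C n * (L * dist x y) := by
  induction n with
  | zero => exact ⟨φ, fun x _ => by simp [displacementConst], fun x _ y _ ⟨c, hc, _⟩ => by omega⟩
  | succ n ih =>
    obtain ⟨g, hg, hg'⟩ := ih
    have hM := displacementConst_nonneg hC n
    have hB := oscillationConst_nonneg hC n
    obtain ⟨Φ, h1, h2, h3⟩ := exists_contraction_step hC hM hL hT hμ hd0 hd hφ (hSΩ n) (hS n)
    refine ⟨fun x => Φ x (g x), fun x hx => ?_, ?_⟩
    · have := dist_triangle (Φ x (g x)) (g x) (φ x)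
      rw [displacementConst, add_mul]
      linarith [h1 x hx _ (hg x hx), hg x hx]
    · rintro x hx y hy ⟨c, hc, hcs⟩
      have hpos : 0 ≤ L * dist x y := by positivity
      rw [oscillationConst, add_mul]
      rcases Nat.lt_succ_iff_lt_or_eq.1 hc with hc | rfl
      · have h4 := h2 x hx y hy _ _ (hg x hx) (hg y hy)
        have h5 := hg' x hx y hy ⟨c, hc, hcs⟩
        have h6 : 16 * C * (5 + 2 * displacementConst C n) * (L * dist x y) ≤
            (38 * C * (5 + 2 * displacementConst C n) + 19 * displacementConst C n + 39) *
              (L * dist x y) := by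
          gcongr
          have : 0 ≤ C * (5 + 2 * displacementConst C n) := by positivity
          linarith
        linarith
      · have h4 := h3 x hx y hy _ _ (hg x hx) (hg y hy) hcs
        have : 0 ≤ oscillationConst C c * (L * dist x y) := by positivity
        linarith

/-! ### Extension -/

/-- Extension into a space with contractible balls. The last conclusion compares the extension with
the values on `A` in terms of the modulus, and so keeps it bounded when `μ` is bounded. -/
theorem exists_extension_of_contractibleBalls {X T : Type*} [NormedAddCommGroup X]
    [NormedSpace ℝ X] [FiniteDimensional ℝ X] [MetricSpace T] {C L : ℝ} (hC : 0 ≤ C) (hL : 0 ≤ L)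
    (hT : ContractibleBalls T C) {μ : ℝ → ℝ} (hμ : IsSublinearModulus μ L) {A : Set X}
    (hA : IsClosed A) (hne : A.Nonempty) (f : A → T)
    (hf : ∀ a b : A, dist (f a) (f b) ≤ μ (dist a b)) {E : ℝ}
    (hE1 : displacementConst C (37 ^ Module.finrank ℝ X + 1) + 3 ≤ E)
    (hE2 : oscillationConst C (37 ^ Module.finrank ℝ X + 1) ≤ E) :
    ∃ g : X → T, (∀ a : A, g a = f a) ∧ (∀ x y, dist (g x) (g y) ≤ E * (L * dist x y)) ∧
      ∀ (x : X) (a : A), dist (g x) (f a) ≤ E * μ (dist x a) := by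
  classical
  obtain ⟨S, hSA, hS, hcov⟩ := exists_colored_whitney_net hA hne
  set n := 37 ^ Module.finrank ℝ X + 1
  have hd0 : ∀ x ∈ Aᶜ, 0 < Metric.infDist x A := fun x hx =>
    (hA.notMem_iff_infDist_pos hne).1 hx
  have hp : ∀ x, ∃ a : A, x ∈ Aᶜ → dist x a ≤ 2 * Metric.infDist x A := by
    intro x
    by_cases hx : x ∈ Aᶜ
    · have h1 : Metric.infDist x A < 2 * Metric.infDist x A := by linarith [hd0 x hx]
      obtain ⟨a, ha, hxa⟩ := (Metric.infDist_lt_iff hne).1 h1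
      exact ⟨⟨a, ha⟩, fun _ => hxa.le⟩
    · exact ⟨⟨hne.some, hne.some_mem⟩, fun h => absurd h hx⟩
  choose p hp using hp
  obtain ⟨g, hg, hg'⟩ := exists_lipschitz_modification hC hL hT hμ hd0
    (fun x y => Metric.infDist_le_infDist_add_dist) (φ := fun x => f (p x))
    (by
      intro x hx y hy
      refine (hf _ _).trans (hμ.mono ?_)
      have h1 := dist_triangle4 (p x : X) x y (p y)
      rw [dist_comm (p x : X) x] at h1
      have h2 : dist (p x) (p y) = dist (p x : X) (p y) := rfl
      linarith [hp x hx, hp y hy])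
    hSA hS n
  have hE0 : 1 ≤ E := by linarith [displacementConst_nonneg hC n]
  have hnear : ∀ x ∈ Aᶜ, ∀ a : A, dist (g x) (f a) ≤ E * μ (dist x a) := by
    intro x hx a
    have h0 : 0 ≤ μ (dist x a) := hμ.nonneg _ dist_nonneg
    have hM := displacementConst_nonneg hC n
    have h1 : Metric.infDist x A ≤ dist x a := Metric.infDist_le_dist_of_mem a.2
    have h2 : dist (p x) a ≤ 3 * dist x a := by
      have h3 := dist_triangle_left (p x : X) a x
      have h4 : dist (p x) a = dist (p x : X) a := rfl
      linarith [hp x hx]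
    calc dist (g x) (f a) ≤ dist (g x) (f (p x)) + dist (f (p x)) (f a) := dist_triangle _ _ _
      _ ≤ displacementConst C n * μ (dist x a) + 3 * μ (dist x a) := by
          refine add_le_add ((hg x hx).trans ?_) ((hf _ _).trans ((hμ.mono h2).trans
            (hμ.dilate 3 _ (by norm_num) dist_nonneg)))
          gcongr
          exact hμ.mono h1
      _ = (displacementConst C n + 3) * μ (dist x a) := by ring
      _ ≤ _ := by gcongr
  let F : X → T := fun x => if h : x ∈ A then f ⟨x, h⟩ else g x
  have hFA : ∀ a : A, F a = f a := fun a => dif_pos a.2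
  have hFn : ∀ x ∈ Aᶜ, F x = g x := fun x hx => dif_neg hx
  have hFa : ∀ (x : X) (a : A), dist (F x) (f a) ≤ E * μ (dist x a) := by
    intro x a
    by_cases hx : x ∈ A
    · lift x to A using hx
      rw [hFA]
      exact (hf x a).trans (le_mul_of_one_le_left (hμ.nonneg _ dist_nonneg) hE0)
    · rw [hFn x hx]
      exact hnear x hx a
  have hFa' : ∀ (x : X) (a : A), dist (F x) (f a) ≤ E * (L * dist x a) := fun x a =>
    (hFa x a).trans (mul_le_mul_of_nonneg_left (hμ.le_mul _ dist_nonneg) (by linarith))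
  refine ⟨F, hFA, fun x y => ?_, hFa⟩
  by_cases hy : y ∈ A
  · lift y to A using hy
    rw [hFA]
    exact hFa' x y
  · by_cases hx : x ∈ A
    · lift x to A using hx
      rw [hFA, dist_comm, dist_comm (x : X)]
      exact hFa' y x
    · rw [hFn x hx, hFn y hy]
      refine (hg' x hx y hy (hcov x hx)).trans ?_
      gcongr

theorem theorem243 (m Q : ℕ) (hQ : 1 ≤ Q) :
    ∃ c : ℝ≥0, 1 ≤ c ∧
      ∀ (X : Type*) [NormedAddCommGroup X] [NormedSpace ℝ X] [FiniteDimensional ℝ X]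
        (Y : Type*) [NormedAddCommGroup Y] [NormedSpace ℝ Y] [CompleteSpace Y],
        Module.finrank ℝ X = m →
        ∀ (A : Set X), IsClosed A →
        ∀ (f : A → Sym Y Q) (L : ℝ≥0), LipschitzWith L f →
          ∃ g : X → Sym Y Q,
            (∀ a : A, g a = f a) ∧
            LipschitzWith (c * L) g ∧
            (A.Nonempty → ∀ v : Sym Y Q,
              (⨆ x : X, ENNReal.ofReal (QValued.gInf (g x) v)) ≤
                c * (⨆ a : A, ENNReal.ofReal (QValued.gInf (f a) v))) := by
  have hC : (0 : ℝ) ≤ 4 * Q + 1 := by positivity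
  have hM := displacementConst_nonneg hC (37 ^ m + 1)
  have hB := oscillationConst_nonneg hC (37 ^ m + 1)
  set E : ℝ := displacementConst (4 * Q + 1) (37 ^ m + 1) + 3 +
    oscillationConst (4 * Q + 1) (37 ^ m + 1)
  have hE0 : 0 ≤ E := by positivity
  -- A value of the extension is within `E * diam (range f) ≤ 2 * E * sup` of the values of `f`.
  obtain ⟨c, hc⟩ : ∃ c : ℝ≥0, (c : ℝ) = 2 * E + 1 :=
    ⟨(2 * E + 1).toNNReal, Real.coe_toNNReal _ (by positivity)⟩
  have hc1 : 1 ≤ c := by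
    rw [← NNReal.coe_le_coe, hc, NNReal.coe_one]
    linarith
  have hc0 : (c : ℝ≥0∞) ≠ 0 := ENNReal.coe_ne_zero.2 (zero_lt_one.trans_le hc1).ne'
  refine ⟨c, hc1, ?_⟩
  intro X _ _ _ Y _ _ _ hX A hA f L hf
  subst hX
  rcases A.eq_empty_or_nonempty with rfl | hne
  · refine ⟨fun _ => QValued.bracket 0, fun a => absurd a.2 (Set.notMem_empty _),
      LipschitzWith.of_dist_le_mul fun x y => ?_, fun h => absurd h Set.not_nonempty_empty⟩
    rw [dist_self]
    positivity
  have hlip : ∀ g : X → Sym Y Q, (∀ x y, dist (g x) (g y) ≤ E * (L * dist x y)) →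
      LipschitzWith (c * L) g := by
    intro g hg
    refine LipschitzWith.of_dist_le_mul fun x y => (hg x y).trans ?_
    rw [NNReal.coe_mul, mul_assoc, hc]
    gcongr
    linarith
  have hT := QValued.contractibleBalls_sym Y Q
  by_cases hb : Bornology.IsBounded (Set.range f)
  · set D := Metric.diam (Set.range f)
    have hfD : ∀ a b, dist (f a) (f b) ≤ D := fun a b =>
      Metric.dist_le_diam_of_mem hb (Set.mem_range_self a) (Set.mem_range_self b)
    obtain ⟨g, hgA, hgL, hgD⟩ := exists_extension_of_contractibleBalls hC L.2 hT
      (isSublinearModulus_min L.2 Metric.diam_nonneg) hA hne f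
      (fun a b => le_min (hf.dist_le_mul a b) (hfD a b)) (E := E) (by linarith) (by linarith)
    refine ⟨g, hgA, hlip g hgL, fun _ v => ?_⟩
    set σ : ℝ≥0∞ := ⨆ a : A, ENNReal.ofReal (QValued.gInf (f a) v)
    have hσa : ∀ a, ENNReal.ofReal (QValued.gInf (f a) v) ≤ σ := fun a =>
      le_iSup (fun a : A => ENNReal.ofReal (QValued.gInf (f a) v)) a
    refine iSup_le fun x => ?_
    by_cases hσt : σ = ⊤
    · rw [hσt, ENNReal.mul_top hc0]
      exact le_top
    have hfv : ∀ a, dist (f a) v ≤ σ.toReal := fun a =>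
      (ENNReal.ofReal_le_iff_le_toReal hσt).1 (hσa a)
    have hD : D ≤ 2 * σ.toReal := by
      refine Metric.diam_le_of_forall_dist_le (by positivity) ?_
      rintro _ ⟨a, rfl⟩ _ ⟨b, rfl⟩
      linarith [dist_triangle_right (f a) (f b) v, hfv a, hfv b]
    let a : A := ⟨hne.some, hne.some_mem⟩
    have hx : dist (g x) v ≤ (2 * E + 1) * σ.toReal := by
      have h1 : dist (g x) (f a) ≤ E * (2 * σ.toReal) :=
        (hgD x a).trans (mul_le_mul_of_nonneg_left ((min_le_right _ _).trans hD) hE0)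
      linarith [dist_triangle (g x) (f a) v, hfv a]
    rw [← ENNReal.ofReal_toReal hσt, ← ENNReal.ofReal_coe_nnreal,
      ← ENNReal.ofReal_mul (NNReal.coe_nonneg _), hc]
    exact ENNReal.ofReal_le_ofReal hx
  -- For unbounded `f` the right-hand side of the last inequality is infinite.
  · obtain ⟨g, hgA, hgL, -⟩ := exists_extension_of_contractibleBalls hC L.2 hT
      (isSublinearModulus_mul L.2) hA hne f (fun a b => hf.dist_le_mul a b) (E := E)
      (by linarith) (by linarith)
    refine ⟨g, hgA, hlip g hgL, fun _ v => ?_⟩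
    have htop : (⨆ a : A, ENNReal.ofReal (QValued.gInf (f a) v)) = ⊤ := by
      by_contra hσt
      refine hb ((Metric.isBounded_iff_subset_closedBall v).2
        ⟨(⨆ a : A, ENNReal.ofReal (QValued.gInf (f a) v)).toReal, ?_⟩)
      rintro _ ⟨a, rfl⟩
      exact (ENNReal.ofReal_le_iff_le_toReal hσt).1
        (le_iSup (fun a : A => ENNReal.ofReal (QValued.gInf (f a) v)) a)
    rw [htop, ENNReal.mul_top hc0]
    exact le_top
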